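/- Let $m\ge 0$ and let $K$ be a simplicial complex on $[m]=\{1,\dots,m\}$, that is, a family of subsets of $[m]$ (its simplices) that contains $\varnothing$ and is closed under taking subsets. (It is not required that every singleton $\{i\}$ be a simplex.) Let $N(K)$ be the set of minimal non-simplices of $K$: the sets $\omega\subseteq[m]$ with $\omega\notin K$ all of whose proper subsets belong to $K$. Let $$\mathcal Z_K=\{z\in\mathbb C^m:\ |z_i|\le 1 \text{ for all } i,\ \{i: |z_i|\neq 1\}\in K\}$$ be the moment-angle complex, on which the torus $T^m=(S^1)^m$ acts by coordinatewise multiplication. The Buchstaber invariant $s(K)$ is the maximal $s$ for which there is a subgroup $H\subseteq T^m$, isomorphic to $T^s$ as a topological group, that acts freely on $\mathcal Z_K$. Then: 1. $s(K)=0$ if and only if $N(K)=\varnothing$; equivalently, if and only if $K$ is the full simplex on $[m]$ (every subset of $[m]$ is a simplex). 2. $s(K)=1$ if and only if $N(K)\ne\varnothing$ and any two and any three distinct sets in $N(K)$ have nonempty intersection. 3. $s(K)=2$ if and only if some two or some three distinct sets in $N(K)$ have empty intersection and $N(K)$ contains none of the following five configurations of pairwise distinct sets: (i) $\tau_1,\dots,\tau_7$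 with $\tau_1\cap\tau_2\cap\tau_4=\tau_1\cap\tau_3\cap\tau_5=\tau_1\cap\tau_6\cap\tau_7=\tau_2\cap\tau_3\cap\tau_6=\tau_2\cap\tau_5\cap\tau_7=\tau_3\cap\tau_4\cap\tau_7=\tau_4\cap\tau_5\cap\tau_6=\varnothing$; (ii) $\tau_1,\dots,\tau_6$ with $\tau_1\cap\tau_3=\tau_1\cap\tau_2\cap\tau_4=\tau_1\cap\tau_2\cap\tau_5=\tau_1\cap\tau_4\cap\tau_6=\tau_1\cap\tau_5\cap\tau_6=\tau_2\cap\tau_3\cap\tau_6=\tau_3\cap\tau_4\cap\tau_5=\varnothing$; (iii) $\tau_1,\dots,\tau_5$ with $\tau_1\cap\tau_2=\tau_1\cap\tau_5=\tau_1\cap\tau_3\cap\tau_4=\tau_2\cap\tau_3\cap\tau_5=\tau_2\cap\tau_4\cap\tau_5=\varnothing$; (iv) $\tau_1,\dots,\tau_4$ with $\tau_1\cap(\tau_2\cup\tau_3\cup\tau_4)=\tau_2\cap\tau_3\cap\tau_4=\varnothing$; (v) $\tau_1,\tau_2,\tau_3$ with $\tau_1\cap\tau_2=\tau_1\cap\tau_3=\tau_2\cap\tau_3=\varnothing$.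 -/

import Mathlib

/-!
Conventions. A simplicial complex `K` on `m` vertices is given by Mathlib's
`PreAbstractSimplicialComplex (Fin m)`: a downward closed family of nonempty subsets of the
`m`-element set. Singletons are not required to belong to it. The empty set, which Mathlib does not
list among the faces, always counts as a simplex (see `IsSimplex`).
-/

namespace Buchstaber

variable {m : ℕ}

/-- `σ` is a simplex of `K`; the empty set always is. -/
def IsSimplex (K : PreAbstractSimplicialComplex (Fin m)) (σ : Finset (Fin m)) : Prop :=
  σ = ∅ ∨ σ ∈ K

/-- `K` is the full simplex on its `m` vertices, i.e. `K` consists of all subsets. -/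
def IsFullSimplex (K : PreAbstractSimplicialComplex (Fin m)) : Prop :=
  ∀ σ : Finset (Fin m), IsSimplex K σ

/-- The set `N(K)` of minimal non-simplices: the non-simplices all of whose proper subsets are
simplices. -/
def minNonSimplices (K : PreAbstractSimplicialComplex (Fin m)) : Set (Finset (Fin m)) :=
  {ω | ¬ IsSimplex K ω ∧ ∀ σ, σ ⊂ ω → IsSimplex K σ}

open Classical in
/-- The `K`-power `(X, A)^K` of a pair of sets `A ⊆ X`: the points of `X^m` for which the set of
coordinates outside `A` is a simplex of `K`. -/
def kPower {E : Type*} (K : PreAbstractSimplicialComplex (Fin m)) (X A : Set E) :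
    Set (Fin m → E) :=
  {x | (∀ i, x i ∈ X) ∧ IsSimplex K (Finset.univ.filter fun i => x i ∉ A)}

/-- The moment-angle complex `(D², S¹)^K`, as a subset of `ℂ^m`. -/
def momentAngleComplex (K : PreAbstractSimplicialComplex (Fin m)) : Set (Fin m → ℂ) :=
  kPower K (Metric.closedBall (0 : ℂ) 1) (Metric.sphere (0 : ℂ) 1)

/-- The subgroup `H` of the torus `T^m` acts freely on the moment-angle complex by coordinatewise
multiplication: only the identity of `H` fixes a point. -/
def ActsFreely (K : PreAbstractSimplicialComplex (Fin m)) (H : Subgroup (Fin m → Circle)) : Prop :=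
  ∀ t ∈ H, ∀ z ∈ momentAngleComplex K, (fun i => (t i : ℂ) * z i) = z → t = 1

/-- The dimensions `s` of toric subgroups of `T^m` (subgroups isomorphic to the torus `T^s` as
topological groups) that act freely on the moment-angle complex. -/
def freeToricDims (K : PreAbstractSimplicialComplex (Fin m)) : Set ℕ :=
  {s | ∃ H : Subgroup (Fin m → Circle), Nonempty (H ≃ₜ* (Fin s → Circle)) ∧ ActsFreely K H}

/-- The Buchstaber invariant `s(K)`: the maximal dimension of a toric subgroup of `T^m` that acts
freely on the moment-angle complex. The maximum exists, see `isGreatest_buchstaberInvariant`. -/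
noncomputable def buchstaberInvariant (K : PreAbstractSimplicialComplex (Fin m)) : ℕ :=
  sSup (freeToricDims K)

theorem zero_mem_freeToricDims (K : PreAbstractSimplicialComplex (Fin m)) :
    0 ∈ freeToricDims K := by
  refine ⟨⊥, ⟨{
    toFun := fun _ => 1
    invFun := fun _ => 1
    left_inv := ?_
    right_inv := ?_
    map_mul' := ?_
    continuous_toFun := continuous_const
    continuous_invFun := continuous_const }⟩, ?_⟩
  · intro x
    exact Subsingleton.elim _ _
  · intro x
    exact Subsingleton.elim _ _
  · intro x y
    exact Subsingleton.elim _ _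
  · intro t ht z _ _
    exact Subgroup.mem_bot.mp ht

/-- A subgroup of `T^m` isomorphic to `T^s` has `s ≤ m`: count the elements of order two. -/
theorem le_of_mem_freeToricDims {K : PreAbstractSimplicialComplex (Fin m)} {s : ℕ}
    (hs : s ∈ freeToricDims K) : s ≤ m := by
  classical
  obtain ⟨H, ⟨e⟩, -⟩ := hs
  obtain ⟨c, hc1, hc2⟩ : ∃ c : Circle, c ≠ 1 ∧ c * c = 1 := by
    refine ⟨Circle.exp Real.pi, ?_, ?_⟩
    · intro h
      have h2 := congrArg (fun z : Circle => (z : ℂ)) h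
      norm_num [Circle.coe_exp, Complex.exp_pi_mul_I] at h2
    · ext
      simp [Circle.coe_exp, Complex.exp_pi_mul_I]
  let x : (Fin s → Bool) → (Fin s → Circle) := fun b i => if b i then c else 1
  have hx : ∀ b, x b * x b = 1 := by
    intro b
    funext i
    by_cases h : b i <;> simp [x, h, hc2]
  let y : (Fin s → Bool) → (Fin m → Circle) := fun b => (e.symm (x b) : H)
  have hy : ∀ b, y b * y b = 1 := by
    intro b
    have h : e.symm (x b) * e.symm (x b) = 1 := by
      rw [← map_mul, hx, map_one]
    exact congrArg Subtype.val h
  have hpm : ∀ b i, (y b i : ℂ) = 1 ∨ (y b i : ℂ) = -1 := by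
    intro b i
    have h := congrArg (fun z : Circle => (z : ℂ)) (congrFun (hy b) i)
    simp only [Pi.mul_apply, Pi.one_apply, Circle.coe_mul, Circle.coe_one] at h
    exact mul_self_eq_one_iff.mp h
  have hinj : Function.Injective fun b : Fin s → Bool => fun i : Fin m => decide (y b i = 1) := by
    intro b b' h
    have hyy : y b = y b' := by
      funext i
      have hi := congrFun h i
      simp only [decide_eq_decide] at hi
      by_cases h1 : y b i = 1
      · rw [h1, hi.mp h1]
      · have h1' : ¬ y b' i = 1 := fun h' => h1 (hi.mpr h')
        ext
        rcases hpm b i with h2 | h2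
        · exact absurd (Circle.ext (by simpa using h2)) h1
        · rcases hpm b' i with h3 | h3
          · exact absurd (Circle.ext (by simpa using h3)) h1'
          · rw [h2, h3]
    have hxx : x b = x b' := e.symm.injective (Subtype.ext hyy)
    funext i
    have hi := congrFun hxx i
    by_cases h1 : b i <;> by_cases h2 : b' i <;> simp_all [x]
  have hcard := Fintype.card_le_of_injective _ hinj
  simp only [Fintype.card_fun, Fintype.card_bool, Fintype.card_fin] at hcard
  exact (Nat.pow_le_pow_iff_right (by norm_num)).mp hcard

/-- The Buchstaber invariant is attained and maximal. -/
theorem isGreatest_buchstaberInvariant (K : PreAbstractSimplicialComplex (Fin m)) :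
    IsGreatest (freeToricDims K) (buchstaberInvariant K) := by
  have hb : BddAbove (freeToricDims K) := ⟨m, fun _ hs => le_of_mem_freeToricDims hs⟩
  exact ⟨Nat.sSup_mem ⟨0, zero_mem_freeToricDims K⟩ hb, fun _ hs => le_csSup hb hs⟩

/-- `N` contains two, or three, distinct sets with empty intersection. -/
def HasDisjointPairOrTriple (N : Set (Finset (Fin m))) : Prop :=
  (∃ τ₁ ∈ N, ∃ τ₂ ∈ N, [τ₁, τ₂].Nodup ∧ τ₁ ∩ τ₂ = ∅) ∨
  (∃ τ₁ ∈ N, ∃ τ₂ ∈ N, ∃ τ₃ ∈ N, [τ₁, τ₂, τ₃].Nodup ∧ τ₁ ∩ τ₂ ∩ τ₃ = ∅)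

/-- First configuration: seven distinct sets. -/
def ConfigOne (N : Set (Finset (Fin m))) : Prop :=
  ∃ τ₁ ∈ N, ∃ τ₂ ∈ N, ∃ τ₃ ∈ N, ∃ τ₄ ∈ N, ∃ τ₅ ∈ N, ∃ τ₆ ∈ N, ∃ τ₇ ∈ N,
    [τ₁, τ₂, τ₃, τ₄, τ₅, τ₆, τ₇].Nodup ∧
    τ₁ ∩ τ₂ ∩ τ₄ = ∅ ∧ τ₁ ∩ τ₃ ∩ τ₅ = ∅ ∧ τ₁ ∩ τ₆ ∩ τ₇ = ∅ ∧ τ₂ ∩ τ₃ ∩ τ₆ = ∅ ∧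
    τ₂ ∩ τ₅ ∩ τ₇ = ∅ ∧ τ₃ ∩ τ₄ ∩ τ₇ = ∅ ∧ τ₄ ∩ τ₅ ∩ τ₆ = ∅

/-- Second configuration: six distinct sets. -/
def ConfigTwo (N : Set (Finset (Fin m))) : Prop :=
  ∃ τ₁ ∈ N, ∃ τ₂ ∈ N, ∃ τ₃ ∈ N, ∃ τ₄ ∈ N, ∃ τ₅ ∈ N, ∃ τ₆ ∈ N,
    [τ₁, τ₂, τ₃, τ₄, τ₅, τ₆].Nodup ∧
    τ₁ ∩ τ₃ = ∅ ∧ τ₁ ∩ τ₂ ∩ τ₄ = ∅ ∧ τ₁ ∩ τ₂ ∩ τ₅ = ∅ ∧ τ₁ ∩ τ₄ ∩ τ₆ = ∅ ∧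
    τ₁ ∩ τ₅ ∩ τ₆ = ∅ ∧ τ₂ ∩ τ₃ ∩ τ₆ = ∅ ∧ τ₃ ∩ τ₄ ∩ τ₅ = ∅

/-- Third configuration: five distinct sets. -/
def ConfigThree (N : Set (Finset (Fin m))) : Prop :=
  ∃ τ₁ ∈ N, ∃ τ₂ ∈ N, ∃ τ₃ ∈ N, ∃ τ₄ ∈ N, ∃ τ₅ ∈ N,
    [τ₁, τ₂, τ₃, τ₄, τ₅].Nodup ∧
    τ₁ ∩ τ₂ = ∅ ∧ τ₁ ∩ τ₅ = ∅ ∧ τ₁ ∩ τ₃ ∩ τ₄ = ∅ ∧ τ₂ ∩ τ₃ ∩ τ₅ = ∅ ∧ τ₂ ∩ τ₄ ∩ τ₅ = ∅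

/-- Fourth configuration: four distinct sets. -/
def ConfigFour (N : Set (Finset (Fin m))) : Prop :=
  ∃ τ₁ ∈ N, ∃ τ₂ ∈ N, ∃ τ₃ ∈ N, ∃ τ₄ ∈ N,
    [τ₁, τ₂, τ₃, τ₄].Nodup ∧ τ₁ ∩ (τ₂ ∪ τ₃ ∪ τ₄) = ∅ ∧ τ₂ ∩ τ₃ ∩ τ₄ = ∅

/-- Fifth configuration: three distinct, pairwise disjoint sets. -/
def ConfigFive (N : Set (Finset (Fin m))) : Prop :=
  ∃ τ₁ ∈ N, ∃ τ₂ ∈ N, ∃ τ₃ ∈ N,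
    [τ₁, τ₂, τ₃].Nodup ∧ τ₁ ∩ τ₂ = ∅ ∧ τ₁ ∩ τ₃ = ∅ ∧ τ₂ ∩ τ₃ = ∅

end Buchstaber

/-!
Write `N` for the set of minimal non-simplices of `K`. A subgroup of `T^m` acts freely on the
moment-angle complex iff the support `{i | t i ≠ 1}` of each of its elements `t ≠ 1` is a
non-simplex. The elements of order two of a freely acting torus of dimension `r` thus form an
`𝔽₂`-linear family of vectors whose supports, if nonempty, are non-simplices. Choosing a member of
`N` inside each support labels the points of the projective space of `𝔽₂^r` by members of `N`, and
the labels of three collinear points have empty intersection, because three ones do not add up to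
zero in `𝔽₂`.

For `r ≤ 3` this can be reversed. The points whose label contains a given `i` contain no line, and
a set of points of dimension `r ≤ 3` without lines misses some hyperplane, whose equation is the
`i`-th coordinate of a linear map with the required supports. This map lifts to a homomorphism of
tori with the same property, because an `r × r` matrix with entries `0` and `1` and odd determinant
has determinant `±1` when `r ≤ 3`.

So `r ≤ s(K)` is, for `r ≤ 3`, the existence of such a labelling. For `r = 1` there is one point
and no line, for `r = 2` there is a single line, and for `r = 3` the points and lines form the Fano
plane: the first configuration is a labelling by distinct sets, the others are what remains when
some labels coincide.
-/

namespace Buchstaber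

variable {m : ℕ}

section Complexes

variable {K : PreAbstractSimplicialComplex (Fin m)}

theorem IsSimplex.mono {σ τ : Finset (Fin m)} (hτ : IsSimplex K τ) (h : σ ⊆ τ) :
    IsSimplex K σ := by
  rcases σ.eq_empty_or_nonempty with rfl | hσ
  · exact .inl rfl
  rcases hτ with rfl | hτ
  · exact .inl (Finset.subset_empty.mp h)
  · exact .inr ((K.isRelLowerSet_faces hτ).2 h hσ)

theorem not_isSimplex_iff_exists_minNonSimplices {ω : Finset (Fin m)} :
    ¬ IsSimplex K ω ↔ ∃ τ ∈ minNonSimplices K, τ ⊆ ω := by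
  refine ⟨fun h => ?_, fun ⟨τ, hτ, hτω⟩ h => hτ.1 (h.mono hτω)⟩
  obtain ⟨τ, hτω, hτ⟩ := exists_minimal_le_of_wellFoundedLT (¬ IsSimplex K ·) ω h
  exact ⟨τ, ⟨hτ.prop, fun σ hσ => not_not.mp (hτ.not_prop_of_lt hσ)⟩, hτω⟩

theorem empty_notMem_minNonSimplices : ∅ ∉ minNonSimplices K :=
  fun h => h.1 (.inl rfl)

theorem isFullSimplex_iff_minNonSimplices_eq_empty :
    IsFullSimplex K ↔ minNonSimplices K = ∅ := by
  refine ⟨fun h => Set.eq_empty_of_forall_notMem fun τ hτ => hτ.1 (h τ), fun h ω => ?_⟩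
  by_contra hω
  obtain ⟨τ, hτ, -⟩ := not_isSimplex_iff_exists_minNonSimplices.mp hω
  simp [h] at hτ

end Complexes

section Tori

variable {K : PreAbstractSimplicialComplex (Fin m)} {r : ℕ}

open Classical in
theorem actsFreely_iff {H : Subgroup (Fin m → Circle)} :
    ActsFreely K H ↔ ∀ t ∈ H, t ≠ 1 → ¬ IsSimplex K {i | t i ≠ 1} := by
  constructor
  · intro h t ht hne hsimplex
    let z : Fin m → ℂ := fun i => if t i = 1 then 1 else 0
    have hz : z ∈ momentAngleComplex K := by
      refine ⟨fun i => ?_, hsimplex.mono fun i hi => ?_⟩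
      · by_cases hi : t i = 1 <;> simp [z, hi]
      · by_contra hti
        simp_all [z]
    refine hne (h t ht z hz (funext fun i => ?_))
    by_cases hi : t i = 1 <;> simp [z, hi]
  · intro h t ht z hz hfix
    by_contra hne
    refine h t ht hne (hz.2.mono fun i hi => ?_)
    have hzi : z i = 0 := by
      by_contra hzi
      exact (Finset.mem_filter.mp hi).2
        (Circle.ext (mul_right_cancel₀ hzi (by simpa using congrFun hfix i)))
    simp [hzi]

open Classical in
theorem mem_freeToricDims_of_hom (φ : (Fin r → Circle) →* (Fin m → Circle)) (hφ : Continuous φ)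
    (h : ∀ t ≠ 1, ¬ IsSimplex K {i | φ t i ≠ 1}) : r ∈ freeToricDims K := by
  have hinj : Function.Injective φ := by
    refine (injective_iff_map_eq_one φ).mpr fun t ht => ?_
    by_contra hne
    exact h t hne (.inl (by simp [ht]))
  have hcont : Continuous (MonoidHom.ofInjective hinj) := hφ.subtype_mk _
  let e : (Fin r → Circle) ≃ₜ* φ.range :=
    { MonoidHom.ofInjective hinj with
      continuous_toFun := hcont
      continuous_invFun := hcont.continuous_symm_of_equiv_compact_to_t2 }
  refine ⟨φ.range, ⟨e.symm⟩, actsFreely_iff.mpr ?_⟩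
  rintro _ ⟨t, rfl⟩ hne
  exact h t fun ht => hne (by rw [ht, map_one])

end Tori

section ModTwo

variable {V : Type*} [AddCommGroup V]

/-- A labelling of the points of the projective space of `V` by members of `N` such that the labels
of three collinear points have empty intersection. Over `𝔽₂` the points are the nonzero vectors,
and three points are collinear when they add up to zero; the value at `0` is irrelevant. -/
def IsLineLabelling {α : Type*} [DecidableEq α] (N : Set (Finset α)) (τ : V → Finset α) : Prop :=
  (∀ v ≠ 0, τ v ∈ N) ∧
    ∀ ⦃u v w⦄, u ≠ 0 → v ≠ 0 → w ≠ 0 → u + v + w = 0 → τ u ∩ τ v ∩ τ w = ∅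

theorem IsLineLabelling.comp {W α : Type*} [AddCommGroup W] [DecidableEq α] {N : Set (Finset α)}
    {τ : W → Finset α} (hτ : IsLineLabelling N τ) (f : V →+ W) (hf : Function.Injective f) :
    IsLineLabelling N (τ ∘ f) := by
  have hne {v : V} (hv : v ≠ 0) : f v ≠ 0 := (map_ne_zero_iff f hf).mpr hv
  refine ⟨fun v hv => hτ.1 _ (hne hv), fun u v w hu hv hw h => ?_⟩
  exact hτ.2 (hne hu) (hne hv) (hne hw) (by rw [← map_add, ← map_add, h, map_zero])

variable {K : PreAbstractSimplicialComplex (Fin m)} [Module (ZMod 2) V]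

/-- The mod-2 analogue of a freely acting subtorus: the support of every nonzero vector in the
image of `Λ` is a non-simplex of `K`. -/
def IsFreeModTwo (K : PreAbstractSimplicialComplex (Fin m))
    (Λ : V →ₗ[ZMod 2] Fin m → ZMod 2) : Prop :=
  ∀ v ≠ 0, ¬ IsSimplex K {i | Λ v i ≠ 0}

theorem IsFreeModTwo.exists_isLineLabelling {Λ : V →ₗ[ZMod 2] Fin m → ZMod 2}
    (h : IsFreeModTwo K Λ) : ∃ τ : V → Finset (Fin m), IsLineLabelling (minNonSimplices K) τ := by
  choose! τ hτ hsupp using fun v hv => not_isSimplex_iff_exists_minNonSimplices.mp (h v hv)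
  refine ⟨τ, hτ, fun u v w hu hv hw huvw => Finset.eq_empty_of_forall_notMem fun i hi => ?_⟩
  have hone {x : V} (hx : x ≠ 0) (hix : i ∈ τ x) : Λ x i = 1 :=
    Fin.eq_one_of_ne_zero _ (Finset.mem_filter.mp (hsupp x hx hix)).2
  simp only [Finset.mem_inter] at hi
  have hsum : Λ u i + Λ v i + Λ w i = 0 := by
    rw [← Pi.add_apply, ← Pi.add_apply, ← map_add, ← map_add, huvw, map_zero, Pi.zero_apply]
  rw [hone hu hi.1.1, hone hv hi.1.2, hone hw hi.2] at hsum
  exact absurd hsum (by decide)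

theorem exists_sum_eq_of_mem_span_zmod_two {S : Set V} {v : V}
    (hv : v ∈ Submodule.span (ZMod 2) S) : ∃ t : Finset V, ↑t ⊆ S ∧ ∑ x ∈ t, x = v := by
  obtain ⟨c, hcS, rfl⟩ := Submodule.mem_span_set.mp hv
  refine ⟨c.support, hcS, Finset.sum_congr rfl fun x hx => ?_⟩
  have hcx : c x = 1 := Fin.eq_one_of_ne_zero _ (Finsupp.mem_support_iff.mp hx)
  simp only [hcx, one_smul]

/-- In dimension four this fails for a basis together with the sum of its vectors: the sum then
has an even number of terms without being a sum of two. -/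
theorem exists_linearMap_eq_one_of_add_add_ne_zero [FiniteDimensional (ZMod 2) V]
    (hV : Module.finrank (ZMod 2) V ≤ 3) {S : Set V}
    (hS : ∀ u ∈ S, ∀ v ∈ S, ∀ w ∈ S, u + v + w ≠ 0) :
    ∃ f : V →ₗ[ZMod 2] ZMod 2, ∀ v ∈ S, f v = 1 := by
  classical
  obtain ⟨b, hbS, hspan, hb : LinearIndepOn (ZMod 2) id b⟩ := exists_linearIndependent (ZMod 2) S
  let f : V →ₗ[ZMod 2] ZMod 2 := (Module.Basis.extend hb).constr (ZMod 2) fun _ => 1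
  have hf {x : V} (hx : x ∈ b) : f x = 1 := by
    simpa only [Module.Basis.extend_apply_self] using
      (Module.Basis.extend hb).constr_basis (ZMod 2) (fun _ => (1 : ZMod 2))
        ⟨x, hb.subset_extend (Set.subset_univ b) hx⟩
  refine ⟨f, fun v hv => ?_⟩
  obtain ⟨t, htb, rfl⟩ := exists_sum_eq_of_mem_span_zmod_two (hspan ▸ Submodule.subset_span hv)
  have hft : f (∑ x ∈ t, x) = t.card := by
    rw [map_sum, Finset.sum_congr rfl fun x hx => hf (htb hx), Finset.sum_const, nsmul_one]
  have hcard : t.card ≤ 3 :=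
    (hb.mono htb).linearIndependent.finset_card_le_finrank.trans hV
  rw [hft]
  interval_cases h : t.card
  · obtain rfl := Finset.card_eq_zero.mp h
    exact absurd (by simp) (hS _ hv _ hv _ hv)
  · rfl
  · obtain ⟨x, y, hxy, rfl⟩ := Finset.card_eq_two.mp h
    have hx : x ∈ S := hbS (htb (by simp))
    have hy : y ∈ S := hbS (htb (by simp))
    refine absurd ?_ (hS x hx y hy _ hv)
    rw [Finset.sum_pair hxy, ZModModule.add_self]
  · rfl

theorem IsLineLabelling.exists_isFreeModTwo [FiniteDimensional (ZMod 2) V]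
    (hV : Module.finrank (ZMod 2) V ≤ 3) {τ : V → Finset (Fin m)}
    (hτ : IsLineLabelling (minNonSimplices K) τ) :
    ∃ Λ : V →ₗ[ZMod 2] Fin m → ZMod 2, IsFreeModTwo K Λ := by
  have hform (i : Fin m) :
      ∃ f : V →ₗ[ZMod 2] ZMod 2, ∀ v ∈ {v | v ≠ 0 ∧ i ∈ τ v}, f v = 1 := by
    refine exists_linearMap_eq_one_of_add_add_ne_zero hV ?_
    rintro u ⟨hu, hiu⟩ v ⟨hv, hiv⟩ w ⟨hw, hiw⟩ h
    have : i ∈ τ u ∩ τ v ∩ τ w := by simp [hiu, hiv, hiw]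
    simp [hτ.2 hu hv hw h] at this
  choose f hf using hform
  refine ⟨LinearMap.pi f, fun v hv => ?_⟩
  refine not_isSimplex_iff_exists_minNonSimplices.mpr ⟨τ v, hτ.1 v hv, fun i hi => ?_⟩
  exact Finset.mem_filter.mpr ⟨Finset.mem_univ i, by simp [hf i v ⟨hv, hi⟩]⟩

end ModTwo

section Torsion

open ZMod (toCircle injective_toCircle)

theorem exists_toCircle_eq_of_pow_eq_one {n : ℕ} [NeZero n] {z : Circle} (hz : z ^ n = 1) :
    ∃ j : ZMod n, toCircle j = z := by
  let ζ : rootsOfUnity n Circle := ⟨toUnits z, by ext; simp [hz]⟩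
  obtain ⟨j, hj⟩ := (bijective_rootsOfUnityAddChar n).2 ζ
  exact ⟨j, by rw [← ZMod.rootsOfUnityAddChar_val, hj]; rfl⟩

theorem exists_addMonoidHom_toCircle_comp_eq {ι κ : Type*} (n : ℕ) [NeZero n]
    (φ : (ι → Circle) →* (κ → Circle)) :
    ∃ Λ : (ι → ZMod n) →+ (κ → ZMod n), ∀ v, toCircle ∘ Λ v = φ (toCircle ∘ v) := by
  have htorsion (v : ι → ZMod n) (k : κ) : φ (toCircle ∘ v) k ^ n = 1 := by
    have hv : (toCircle ∘ v) ^ n = 1 := by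
      ext i
      simp [← AddChar.map_nsmul_eq_pow]
    rw [← Pi.pow_apply, ← map_pow, hv, map_one, Pi.one_apply]
  choose Λ hΛ using fun v k => exists_toCircle_eq_of_pow_eq_one (htorsion v k)
  refine ⟨AddMonoidHom.mk' Λ fun u v => funext fun k => injective_toCircle ?_, fun v => ?_⟩
  · have hadd : toCircle ∘ (u + v) = toCircle ∘ u * toCircle ∘ v :=
      funext fun i => AddChar.map_add_eq_mul _ (u i) (v i)
    rw [hΛ, hadd, map_mul, Pi.mul_apply, Pi.add_apply, AddChar.map_add_eq_mul, hΛ, hΛ]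
  · exact funext (hΛ v)

theorem exists_isFreeModTwo_of_mem_freeToricDims {K : PreAbstractSimplicialComplex (Fin m)}
    {s : ℕ} (hs : s ∈ freeToricDims K) :
    ∃ Λ : (Fin s → ZMod 2) →ₗ[ZMod 2] Fin m → ZMod 2, IsFreeModTwo K Λ := by
  obtain ⟨H, ⟨e⟩, hH⟩ := hs
  let φ : (Fin s → Circle) →* (Fin m → Circle) := H.subtype.comp e.symm.toMonoidHom
  obtain ⟨Λ, hΛ⟩ := exists_addMonoidHom_toCircle_comp_eq 2 φ
  refine ⟨Λ.toZModLinearMap 2, fun v hv => ?_⟩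
  have hφ : φ (toCircle ∘ v) ≠ 1 := by
    rw [Ne, map_eq_one_iff φ (H.subtype_injective.comp e.symm.injective)]
    exact fun h => hv (funext fun i => injective_toCircle
      ((congrFun h i).trans (AddChar.map_zero_eq_one _).symm))
  convert actsFreely_iff.mp hH (φ (toCircle ∘ v)) (e.symm _).2 hφ using 5 with i
  rw [← hΛ, Function.comp_apply, AddMonoidHom.coe_toZModLinearMap, ← injective_toCircle.eq_iff,
    AddChar.map_zero_eq_one]

end Torsion

section Lift

open scoped Nat

variable {ι κ G : Type*} [Fintype κ] [CommGroup G]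

/-- The homomorphism `G^κ → G^ι` of abelian groups given by an integer matrix `A` acting on `G^κ`
written multiplicatively; for the circle these are the homomorphisms of tori. -/
def monomialHom (G : Type*) [CommGroup G] (A : Matrix ι κ ℤ) :
    (κ → G) →* (ι → G) where
  toFun t i := ∏ j, t j ^ A i j
  map_one' := by ext; simp
  map_mul' s t := by ext; simp [mul_zpow, Finset.prod_mul_distrib]

theorem monomialHom_apply (A : Matrix ι κ ℤ) (t : κ → G) (i : ι) :
    monomialHom G A t i = ∏ j, t j ^ A i j :=
  rfl

theorem continuous_monomialHom [TopologicalSpace G] [IsTopologicalGroup G]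
    (A : Matrix ι κ ℤ) : Continuous (monomialHom G A) := by
  refine continuous_pi fun i => ?_
  simp only [monomialHom_apply]
  fun_prop

theorem monomialHom_one [DecidableEq κ] (t : κ → G) :
    monomialHom G (1 : Matrix κ κ ℤ) t = t := by
  ext i
  simp [monomialHom_apply, Matrix.one_apply, Finset.prod_ite_eq]

theorem monomialHom_mul {l : Type*} [Fintype l] (A : Matrix ι κ ℤ) (B : Matrix κ l ℤ)
    (t : l → G) : monomialHom G (A * B) t = monomialHom G A (monomialHom G B t) := by
  ext i
  simp only [monomialHom_apply, Matrix.mul_apply, ← Finset.prod_zpow, ← zpow_mul']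
  rw [Finset.prod_comm]
  exact Finset.prod_congr rfl fun j _ => map_prod (zpowersHom G (t j)) _ _

theorem monomialHom_injective_of_isUnit_det [DecidableEq κ] {A : Matrix κ κ ℤ}
    (hA : IsUnit A.det) : Function.Injective (monomialHom G A) := by
  refine Function.LeftInverse.injective (g := monomialHom G A⁻¹) fun t => ?_
  rw [← monomialHom_mul, Matrix.nonsing_inv_mul A hA, monomialHom_one]

theorem abs_det_le_factorial {n : ℕ} (A : Matrix (Fin (n + 1)) (Fin (n + 1)) ℤ)
    (hA : ∀ i j, A i j = 0 ∨ A i j = 1) : |A.det| ≤ (n)! := by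
  induction n with
  | zero => rcases hA 0 0 with h | h <;> simp [h]
  | succ n ih =>
    by_cases hzero : ∃ i j, A i j = 0
    · obtain ⟨i, j, hij⟩ := hzero
      have hterm (k : Fin (n + 2)) :
          |(-1) ^ (i + k : ℕ) * A i k * (A.submatrix i.succAbove k.succAbove).det| ≤ (n)! := by
        rcases hA i k with h | h
        · simp [h]
        · simpa [h, abs_mul] using ih (A.submatrix i.succAbove k.succAbove) fun _ _ => hA _ _
      rw [Matrix.det_succ_row A i, ← Finset.sum_erase Finset.univ (a := j) (by simp [hij])]
      refine (Finset.abs_sum_le_sum_abs _ _).trans ?_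
      refine (Finset.sum_le_card_nsmul _ _ _ fun k _ => hterm k).trans_eq ?_
      simp [Nat.factorial_succ]
    · push Not at hzero
      have hone (i j : Fin (n + 2)) : A i j = 1 := (hA i j).resolve_left (hzero i j)
      have hdet : A.det = 0 :=
        Matrix.det_zero_of_row_eq Fin.zero_ne_one (funext fun j => by rw [hone, hone])
      simp [hdet]

theorem isUnit_det_of_odd {n : ℕ} (hn : n ≤ 3) {A : Matrix (Fin n) (Fin n) ℤ}
    (hA : ∀ i j, A i j = 0 ∨ A i j = 1) (hodd : Odd A.det) : IsUnit A.det := by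
  cases n with
  | zero => simp
  | succ n =>
    have hdet : |A.det| ≤ 2 := (abs_det_le_factorial A hA).trans
      (by exact_mod_cast Nat.factorial_le (show n ≤ 2 by omega))
    rw [abs_le] at hdet
    rw [Int.isUnit_iff]
    grind

theorem exists_isUnit_submatrix {ι F : Type*} [Finite ι] [Field F] {n : ℕ}
    (A : Matrix ι (Fin n) F) (hA : Function.Injective A.mulVec) :
    ∃ c : Fin n → ι, IsUnit (A.submatrix c id) := by
  have hrank : Module.finrank F (Submodule.span F (Set.range A.row)) = n := by
    rw [← A.rank_eq_finrank_span_row, Matrix.rank, LinearMap.finrank_range_of_inj hA,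
      Module.finrank_fin_fun]
  obtain ⟨f, hf, -, hind⟩ := Submodule.exists_fun_fin_finrank_span_eq F (Set.range A.row)
  choose c hc using hf
  refine ⟨c ∘ Fin.cast hrank.symm, ?_⟩
  have hrow : (A.submatrix (c ∘ Fin.cast hrank.symm) id).row = f ∘ Fin.cast hrank.symm :=
    funext fun _ => hc _
  rw [← Matrix.linearIndependent_rows_iff_isUnit, hrow]
  exact hind.comp _ (Fin.cast_injective hrank.symm)

theorem isUnit_det_map_val {n : ℕ} (hn : n ≤ 3) {B : Matrix (Fin n) (Fin n) (ZMod 2)}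
    (hB : IsUnit B) : IsUnit (B.map fun x => (x.val : ℤ)).det := by
  have hval : ∀ x : ZMod 2, (x.val : ℤ) = 0 ∨ (x.val : ℤ) = 1 := by decide
  refine isUnit_det_of_odd hn (fun i j => hval (B i j)) ?_
  have hdet : ((B.map fun x => (x.val : ℤ)).det : ZMod 2) = B.det := by
    rw [Int.cast_det]
    congr 1
    ext i j
    simp
  rw [← ZMod.intCast_eq_one_iff_odd, hdet]
  exact Fin.eq_one_of_ne_zero _ (B.isUnit_iff_isUnit_det.mp hB).ne_zero

open Classical in
theorem mem_freeToricDims_of_isFreeModTwo {K : PreAbstractSimplicialComplex (Fin m)} {r : ℕ}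
    (hr : r ≤ 3) {Λ : (Fin r → ZMod 2) →ₗ[ZMod 2] Fin m → ZMod 2} (hΛ : IsFreeModTwo K Λ) :
    r ∈ freeToricDims K := by
  let B : Matrix (Fin m) (Fin r) (ZMod 2) := LinearMap.toMatrix' Λ
  let A : Matrix (Fin m) (Fin r) ℤ := B.map fun x => (x.val : ℤ)
  refine mem_freeToricDims_of_hom (monomialHom Circle A) (continuous_monomialHom A) fun t => ?_
  contrapose!
  intro hσ
  let E := {i // monomialHom Circle A t i = 1}
  have hinj : Function.Injective (B.submatrix ((↑) : E → Fin m) id).mulVec := by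
    refine (injective_iff_map_eq_zero (Matrix.mulVecLin _)).mpr fun v hv => ?_
    by_contra hne
    refine hΛ v hne (hσ.mono fun i hi => ?_)
    simp only [Finset.mem_filter_univ] at hi ⊢
    refine fun hE => hi ?_
    rw [← LinearMap.toMatrix'_mulVec Λ]
    exact congrFun hv ⟨i, hE⟩
  obtain ⟨c, hc⟩ := exists_isUnit_submatrix _ hinj
  refine monomialHom_injective_of_isUnit_det (isUnit_det_map_val hr hc) ?_
  rw [map_one]
  exact funext fun j => (c j).2

end Lift

section Labellings

variable {N : Set (Finset (Fin m))}

theorem ne_of_inter_eq_empty (hN : ∅ ∉ N) {σ τ : Finset (Fin m)} (hσ : σ ∈ N) (h : σ ∩ τ = ∅) :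
    σ ≠ τ := by
  rintro rfl
  rw [Finset.inter_self] at h
  exact hN (h ▸ hσ)

theorem hasDisjointPairOrTriple_iff (hN : ∅ ∉ N) :
    HasDisjointPairOrTriple N ↔ ∃ τ₁ ∈ N, ∃ τ₂ ∈ N, ∃ τ₃ ∈ N, τ₁ ∩ τ₂ ∩ τ₃ = ∅ := by
  constructor
  · rintro (⟨τ₁, h₁, τ₂, h₂, -, h⟩ | ⟨τ₁, h₁, τ₂, h₂, τ₃, h₃, -, h⟩)
    · exact ⟨τ₁, h₁, τ₂, h₂, τ₂, h₂, by simp [h]⟩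
    · exact ⟨τ₁, h₁, τ₂, h₂, τ₃, h₃, h⟩
  · rintro ⟨τ₁, h₁, τ₂, h₂, τ₃, h₃, h⟩
    have pair {σ τ} (hσ : σ ∈ N) (hτ : τ ∈ N) (hστ : σ ∩ τ = ∅) : HasDisjointPairOrTriple N :=
      .inl ⟨σ, hσ, τ, hτ, by simpa using ne_of_inter_eq_empty hN hσ hστ, hστ⟩
    rcases eq_or_ne τ₁ τ₂ with rfl | n₁₂
    · exact pair h₁ h₃ (by simpa using h)
    rcases eq_or_ne τ₁ τ₃ with rfl | n₁₃
    · rw [Finset.inter_right_comm] at h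
      exact pair h₁ h₂ (by simpa using h)
    rcases eq_or_ne τ₂ τ₃ with rfl | n₂₃
    · exact pair h₁ h₂ (by simpa [Finset.inter_assoc] using h)
    exact .inr ⟨τ₁, h₁, τ₂, h₂, τ₃, h₃, by simp [*], h⟩

theorem isLineLabelling_of_lines {V : Type*} [AddCommGroup V] [DecidableEq V]
    {τ : V → Finset (Fin m)} (L : Finset (Finset V))
    (hL : ∀ u v w : V, u ≠ 0 → v ≠ 0 → w ≠ 0 → u + v + w = 0 → {u, v, w} ∈ L)
    (hN : ∀ v ≠ 0, τ v ∈ N) (h : ∀ l ∈ L, l.inf τ = ∅) : IsLineLabelling N τ := by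
  refine ⟨hN, fun u v w hu hv hw huvw => ?_⟩
  simpa [Finset.inter_assoc] using h _ (hL u v w hu hv hw huvw)

theorem exists_isLineLabelling_fin_two_iff :
    (∃ τ : (Fin 2 → ZMod 2) → Finset (Fin m), IsLineLabelling N τ) ↔
      ∃ τ₁ ∈ N, ∃ τ₂ ∈ N, ∃ τ₃ ∈ N, τ₁ ∩ τ₂ ∩ τ₃ = ∅ := by
  constructor
  · rintro ⟨τ, hτN, hτ⟩
    exact ⟨τ ![1, 0], hτN _ (by decide), τ ![0, 1], hτN _ (by decide), τ ![1, 1],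
      hτN _ (by decide), hτ (by decide) (by decide) (by decide) (by decide)⟩
  · rintro ⟨τ₁, h₁, τ₂, h₂, τ₃, h₃, h⟩
    let τ : (Fin 2 → ZMod 2) → Finset (Fin m) := fun v => ![![∅, τ₂], ![τ₁, τ₃]] (v 0) (v 1)
    refine ⟨τ, isLineLabelling_of_lines {{![1, 0], ![0, 1], ![1, 1]}} (by decide) ?_ ?_⟩
    · intro v hv
      rcases (by decide : ∀ v : Fin 2 → ZMod 2, v ≠ 0 → v = ![1, 0] ∨ v = ![0, 1] ∨ v = ![1, 1])
        v hv with rfl | rfl | rfl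
      exacts [h₁, h₂, h₃]
    · simp only [Finset.mem_singleton, forall_eq, Finset.inf_insert, Finset.inf_singleton,
        Finset.inf_eq_inter, ← Finset.inter_assoc]
      exact h

theorem exists_isLineLabelling_of_fano {τ₁ τ₂ τ₃ τ₄ τ₅ τ₆ τ₇ : Finset (Fin m)}
    (h₁ : τ₁ ∈ N) (h₂ : τ₂ ∈ N) (h₃ : τ₃ ∈ N) (h₄ : τ₄ ∈ N) (h₅ : τ₅ ∈ N) (h₆ : τ₆ ∈ N)
    (h₇ : τ₇ ∈ N) (h₁₂₄ : τ₁ ∩ τ₂ ∩ τ₄ = ∅) (h₁₃₅ : τ₁ ∩ τ₃ ∩ τ₅ = ∅)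
    (h₁₆₇ : τ₁ ∩ τ₆ ∩ τ₇ = ∅) (h₂₃₆ : τ₂ ∩ τ₃ ∩ τ₆ = ∅) (h₂₅₇ : τ₂ ∩ τ₅ ∩ τ₇ = ∅)
    (h₃₄₇ : τ₃ ∩ τ₄ ∩ τ₇ = ∅) (h₄₅₆ : τ₄ ∩ τ₅ ∩ τ₆ = ∅) :
    ∃ τ : (Fin 3 → ZMod 2) → Finset (Fin m), IsLineLabelling N τ := by
  let τ : (Fin 3 → ZMod 2) → Finset (Fin m) := fun v =>
    ![![![∅, τ₃], ![τ₂, τ₆]], ![![τ₁, τ₅], ![τ₄, τ₇]]] (v 0) (v 1) (v 2)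
  refine ⟨τ, isLineLabelling_of_lines {
    {![1, 0, 0], ![0, 1, 0], ![1, 1, 0]}, {![1, 0, 0], ![0, 0, 1], ![1, 0, 1]},
    {![1, 0, 0], ![0, 1, 1], ![1, 1, 1]}, {![0, 1, 0], ![0, 0, 1], ![0, 1, 1]},
    {![0, 1, 0], ![1, 0, 1], ![1, 1, 1]}, {![0, 0, 1], ![1, 1, 0], ![1, 1, 1]},
    {![1, 1, 0], ![1, 0, 1], ![0, 1, 1]}} (by decide) ?_ ?_⟩
  · intro v hv
    rcases (by decide : ∀ v : Fin 3 → ZMod 2, v ≠ 0 → v = ![1, 0, 0] ∨ v = ![0, 1, 0] ∨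
      v = ![0, 0, 1] ∨ v = ![1, 1, 0] ∨ v = ![1, 0, 1] ∨ v = ![0, 1, 1] ∨ v = ![1, 1, 1])
      v hv with rfl | rfl | rfl | rfl | rfl | rfl | rfl
    exacts [h₁, h₂, h₃, h₄, h₅, h₆, h₇]
  · simp only [Finset.forall_mem_insert, Finset.mem_singleton, forall_eq, Finset.inf_insert,
      Finset.inf_singleton, Finset.inf_eq_inter, ← Finset.inter_assoc]
    exact ⟨h₁₂₄, h₁₃₅, h₁₆₇, h₂₃₆, h₂₅₇, h₃₄₇, h₄₅₆⟩

end Labellings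

section Configurations

variable {N : Set (Finset (Fin m))}

theorem configFour_or_configFive (hN : ∅ ∉ N) {τ₁ τ₂ τ₃ τ₄ : Finset (Fin m)}
    (h₁ : τ₁ ∈ N) (h₂ : τ₂ ∈ N) (h₃ : τ₃ ∈ N) (h₄ : τ₄ ∈ N) (h₁₂ : τ₁ ∩ τ₂ = ∅)
    (h₁₃ : τ₁ ∩ τ₃ = ∅) (h₁₄ : τ₁ ∩ τ₄ = ∅) (h₂₃₄ : τ₂ ∩ τ₃ ∩ τ₄ = ∅) :
    ConfigFour N ∨ ConfigFive N := by
  have n₁₂ := ne_of_inter_eq_empty hN h₁ h₁₂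
  have n₁₃ := ne_of_inter_eq_empty hN h₁ h₁₃
  have n₁₄ := ne_of_inter_eq_empty hN h₁ h₁₄
  have five (h₂₃ : τ₂ ∩ τ₃ = ∅) : ConfigFive N :=
    ⟨τ₁, h₁, τ₂, h₂, τ₃, h₃, by simp [ne_of_inter_eq_empty hN h₂ h₂₃, *], h₁₂, h₁₃, h₂₃⟩
  rcases eq_or_ne τ₂ τ₃ with rfl | n₂₃
  · rw [Finset.inter_self] at h₂₃₄
    exact .inr ⟨τ₁, h₁, τ₂, h₂, τ₄, h₄, by simp [ne_of_inter_eq_empty hN h₂ h₂₃₄, *],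
      h₁₂, h₁₄, h₂₃₄⟩
  rcases eq_or_ne τ₂ τ₄ with rfl | n₂₄
  · exact .inr (five (by rwa [Finset.inter_right_comm, Finset.inter_self] at h₂₃₄))
  rcases eq_or_ne τ₃ τ₄ with rfl | n₃₄
  · exact .inr (five (by rwa [Finset.inter_assoc, Finset.inter_self] at h₂₃₄))
  exact .inl ⟨τ₁, h₁, τ₂, h₂, τ₃, h₃, τ₄, h₄, by simp [*],
    by simp [Finset.inter_union_distrib_left, *], h₂₃₄⟩

theorem configThree_or_configFour_or_configFive (hN : ∅ ∉ N) {τ₁ τ₂ τ₃ τ₄ τ₅ : Finset (Fin m)}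
    (h₁ : τ₁ ∈ N) (h₂ : τ₂ ∈ N) (h₃ : τ₃ ∈ N) (h₄ : τ₄ ∈ N) (h₅ : τ₅ ∈ N)
    (h₁₂ : τ₁ ∩ τ₂ = ∅) (h₁₅ : τ₁ ∩ τ₅ = ∅) (h₁₃₄ : τ₁ ∩ τ₃ ∩ τ₄ = ∅)
    (h₂₃₅ : τ₂ ∩ τ₃ ∩ τ₅ = ∅) (h₂₄₅ : τ₂ ∩ τ₄ ∩ τ₅ = ∅) :
    ConfigThree N ∨ ConfigFour N ∨ ConfigFive N := by
  have n₁₂ := ne_of_inter_eq_empty hN h₁ h₁₂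
  have n₁₅ := ne_of_inter_eq_empty hN h₁ h₁₅
  have four {σ₁ σ₂ σ₃ σ₄} := @configFour_or_configFive m N hN σ₁ σ₂ σ₃ σ₄
  by_cases hnodup : [τ₁, τ₂, τ₃, τ₄, τ₅].Nodup
  · exact .inl ⟨τ₁, h₁, τ₂, h₂, τ₃, h₃, τ₄, h₄, τ₅, h₅, hnodup, h₁₂, h₁₅, h₁₃₄, h₂₃₅, h₂₄₅⟩
  right
  obtain rfl | rfl | rfl | rfl | rfl | rfl | rfl | rfl : τ₁ = τ₃ ∨ τ₁ = τ₄ ∨ τ₂ = τ₃ ∨ τ₂ = τ₄ ∨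
      τ₂ = τ₅ ∨ τ₃ = τ₄ ∨ τ₃ = τ₅ ∨ τ₄ = τ₅ := by
    by_contra! hne
    exact hnodup (by simp [n₁₂, n₁₅, hne])
  · exact four h₁ h₂ h₄ h₅ h₁₂ (by rwa [Finset.inter_self] at h₁₃₄) h₁₅ h₂₄₅
  · exact four h₁ h₂ h₃ h₅ h₁₂ (by rwa [Finset.inter_right_comm, Finset.inter_self] at h₁₃₄)
      h₁₅ h₂₃₅
  · exact four h₁ h₂ h₂ h₅ h₁₂ h₁₂ h₁₅ h₂₃₅
  · exact four h₁ h₂ h₂ h₅ h₁₂ h₁₂ h₁₅ h₂₄₅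
  · rw [Finset.inter_right_comm, Finset.inter_self] at h₂₃₅ h₂₄₅
    exact four h₂ h₁ h₃ h₄ (by rwa [Finset.inter_comm]) h₂₃₅ h₂₄₅ h₁₃₄
  · exact four h₁ h₂ h₃ h₅ h₁₂ (by rwa [Finset.inter_assoc, Finset.inter_self] at h₁₃₄) h₁₅ h₂₃₅
  · exact four h₁ h₂ h₂ h₃ h₁₂ h₁₂ h₁₅
      (by rwa [Finset.inter_self, ← Finset.inter_self τ₃, ← Finset.inter_assoc])
  · exact four h₁ h₂ h₂ h₄ h₁₂ h₁₂ h₁₅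
      (by rwa [Finset.inter_self, ← Finset.inter_self τ₄, ← Finset.inter_assoc])

section Fano

variable {V : Type*} [AddCommGroup V]

/-- The seven points of the Fano plane spanned by `p`, `q`, `r`, in the order in which `ConfigOne`
lists their labels. -/
def fanoPoints (p q r : V) : List V :=
  [p, q, r, p + q, p + r, q + r, p + q + r]

variable {p q r : V}

theorem IsLineLabelling.apply_mem_of_mem_fanoPoints {τ : V → Finset (Fin m)}
    (hτ : IsLineLabelling N τ) (hpqr : (0 :: fanoPoints p q r).Nodup) {v : V}
    (hv : v ∈ fanoPoints p q r) : τ v ∈ N :=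
  hτ.1 v fun h => (List.nodup_cons.mp hpqr).1 (h ▸ hv)

variable [Module (ZMod 2) V]

theorem nodup_zero_cons_fanoPoints (hp : p ≠ 0) (hq : q ≠ 0) (hr : r ≠ 0) (hpq : p ≠ q)
    (hpr : p ≠ r) (hqr : q ≠ r) (hpqr : p + q ≠ r) : (0 :: fanoPoints p q r).Nodup := by
  have eq_iff {u v : V} : u + v = 0 ↔ u = v := by
    rw [← ZModModule.sub_eq_add, sub_eq_zero]
  have hp' : p ≠ q + r := fun h => hpqr (by
    rw [h, add_right_comm, ZModModule.add_self, zero_add])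
  have hq' : q ≠ p + r := fun h => hpqr (by
    rw [h, ← add_assoc, ZModModule.add_self, zero_add])
  have hq'' : q ≠ p + (q + r) := by simpa [add_left_comm p, eq_iff] using hpr
  have hr' : r ≠ p + (q + r) := by simpa [← add_assoc, eq_iff] using hpq
  have hqr' : p + q ≠ q + r := by rwa [add_comm, Ne, add_right_inj]
  simp [fanoPoints, add_assoc, eq_comm (a := (0 : V)), *, hpqr.symm]

namespace IsLineLabelling

variable {τ : V → Finset (Fin m)}

theorem fano_lines (hτ : IsLineLabelling N τ) (hpqr : (0 :: fanoPoints p q r).Nodup) :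
    τ p ∩ τ q ∩ τ (p + q) = ∅ ∧ τ p ∩ τ r ∩ τ (p + r) = ∅ ∧
      τ p ∩ τ (q + r) ∩ τ (p + q + r) = ∅ ∧ τ q ∩ τ r ∩ τ (q + r) = ∅ ∧
      τ q ∩ τ (p + r) ∩ τ (p + q + r) = ∅ ∧ τ r ∩ τ (p + q) ∩ τ (p + q + r) = ∅ ∧
      τ (p + q) ∩ τ (p + r) ∩ τ (q + r) = ∅ := by
  have hne : ∀ v ∈ fanoPoints p q r, v ≠ 0 :=
    fun v hv h => (List.nodup_cons.mp hpqr).1 (h ▸ hv)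
  simp only [fanoPoints, List.forall_mem_cons] at hne
  obtain ⟨h₁, h₂, h₃, h₄, h₅, h₆, h₇, -⟩ := hne
  have line {u v w : V} (h : u + v = w) : u + v + w = 0 := by rw [h, ZModModule.add_self]
  exact ⟨hτ.2 h₁ h₂ h₄ (line rfl), hτ.2 h₁ h₃ h₅ (line rfl),
    hτ.2 h₁ h₆ h₇ (line (add_assoc p q r).symm), hτ.2 h₂ h₃ h₆ (line rfl),
    hτ.2 h₂ h₅ h₇ (line (by abel)), hτ.2 h₃ h₄ h₇ (line (add_comm r _)),
    hτ.2 h₄ h₅ h₆ (line (by rw [add_add_add_comm, ZModModule.add_self, zero_add]))⟩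

theorem configOne (hτ : IsLineLabelling N τ) (hpqr : (0 :: fanoPoints p q r).Nodup)
    (hinj : Set.InjOn τ {0}ᶜ) : ConfigOne N := by
  obtain ⟨hzero, hnodup⟩ := List.nodup_cons.mp hpqr
  have hlabels : ((fanoPoints p q r).map τ).Nodup :=
    hnodup.map_on fun u hu v hv =>
      hinj (ne_of_mem_of_not_mem hu hzero) (ne_of_mem_of_not_mem hv hzero)
  have hN : ∀ v ∈ fanoPoints p q r, τ v ∈ N := fun _ => hτ.apply_mem_of_mem_fanoPoints hpqr
  simp only [fanoPoints, List.forall_mem_cons] at hN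
  obtain ⟨h₁, h₂, h₃, h₄, h₅, h₆, h₇, -⟩ := hN
  exact ⟨_, h₁, _, h₂, _, h₃, _, h₄, _, h₅, _, h₆, _, h₇, hlabels, hτ.fano_lines hpqr⟩

theorem configTwo (hτ : IsLineLabelling N τ) (hpqr : (0 :: fanoPoints p q r).Nodup)
    (hpq : τ p = τ q) (hinj : Set.InjOn τ {0, q}ᶜ) : ConfigTwo N := by
  have hlabels : ([p, r, p + q, p + r, q + r, p + q + r].map τ).Nodup := by
    have hnodup : (0 :: q :: [p, r, p + q, p + r, q + r, p + q + r]).Nodup :=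
      hpqr.perm (.cons 0 (.swap q p _))
    refine (hnodup.sublist (by simp)).map_on fun u hu v hv => hinj ?_ ?_ <;> grind
  have hN : ∀ v ∈ fanoPoints p q r, τ v ∈ N := fun _ => hτ.apply_mem_of_mem_fanoPoints hpqr
  simp only [fanoPoints, List.forall_mem_cons] at hN
  obtain ⟨h₁, -, h₃, h₄, h₅, h₆, h₇, -⟩ := hN
  obtain ⟨h₁₂₄, h₁₃₅, h₁₆₇, h₂₃₆, h₂₅₇, h₃₄₇, h₄₅₆⟩ := hτ.fano_lines hpqr
  rw [← hpq] at h₁₂₄ h₂₃₆ h₂₅₇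
  rw [Finset.inter_self] at h₁₂₄
  exact ⟨_, h₁, _, h₃, _, h₄, _, h₅, _, h₆, _, h₇, hlabels,
    h₁₂₄, h₁₃₅, h₂₃₆, h₂₅₇, h₁₆₇, h₃₄₇, h₄₅₆⟩

theorem configFour_or_configFive (hτ : IsLineLabelling N τ) (hN : ∅ ∉ N) (hp : p ≠ 0) (hq : q ≠ 0)
    (hr : r ≠ 0) (hpq : p ≠ q) (hpr : p ≠ r) (hqr : q ≠ r) (hτpq : τ p = τ q) (hτpr : τ p = τ r) :
    ConfigFour N ∨ ConfigFive N := by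
  have hline : p + q ≠ r := by
    intro h
    have hempty := hτ.2 hp hq hr (by rw [h, ZModModule.add_self])
    rw [← hτpq, ← hτpr, Finset.inter_self, Finset.inter_self] at hempty
    exact hN (hempty ▸ hτ.1 p hp)
  have hpqr := nodup_zero_cons_fanoPoints hp hq hr hpq hpr hqr hline
  have hmem : ∀ v ∈ fanoPoints p q r, τ v ∈ N := fun _ => hτ.apply_mem_of_mem_fanoPoints hpqr
  simp only [fanoPoints, List.forall_mem_cons] at hmem
  obtain ⟨h₁, -, -, h₄, h₅, h₆, -⟩ := hmem
  obtain ⟨h₁₂₄, h₁₃₅, -, h₂₃₆, -, -, h₄₅₆⟩ := hτ.fano_lines hpqr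
  rw [← hτpq, Finset.inter_self] at h₁₂₄
  rw [← hτpr, Finset.inter_self] at h₁₃₅
  rw [← hτpq, ← hτpr, Finset.inter_self] at h₂₃₆
  exact Buchstaber.configFour_or_configFive hN h₁ h₄ h₅ h₆ h₁₂₄ h₁₃₅ h₂₃₆ h₄₅₆

theorem config_of_apply_add_add (hτ : IsLineLabelling N τ) (hN : ∅ ∉ N)
    (hpqr : (0 :: fanoPoints p q r).Nodup) (hpq : τ p = τ q) (hr : τ (p + q + r) = τ r) :
    ConfigThree N ∨ ConfigFour N ∨ ConfigFive N := by
  have hmem : ∀ v ∈ fanoPoints p q r, τ v ∈ N := fun _ => hτ.apply_mem_of_mem_fanoPoints hpqr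
  simp only [fanoPoints, List.forall_mem_cons] at hmem
  obtain ⟨h₁, -, h₃, h₄, h₅, h₆, -⟩ := hmem
  obtain ⟨h₁₂₄, -, h₁₆₇, -, h₂₅₇, h₃₄₇, h₄₅₆⟩ := hτ.fano_lines hpqr
  rw [← hpq, Finset.inter_self, Finset.inter_comm] at h₁₂₄
  rw [hr] at h₁₆₇
  rw [← hpq, hr] at h₂₅₇
  rw [hr, Finset.inter_comm, ← Finset.inter_assoc, Finset.inter_self, Finset.inter_comm] at h₃₄₇
  exact configThree_or_configFour_or_configFive hN h₄ h₁ h₅ h₆ h₃ h₁₂₄ h₃₄₇ h₄₅₆ h₂₅₇ h₁₆₇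

theorem config_of_apply_add (hτ : IsLineLabelling N τ) (hN : ∅ ∉ N)
    (hpqr : (0 :: fanoPoints p q r).Nodup) (hpq : τ p = τ q) (hr : τ (p + q) = τ r) :
    ConfigThree N ∨ ConfigFour N ∨ ConfigFive N := by
  have hmem : ∀ v ∈ fanoPoints p q r, τ v ∈ N := fun _ => hτ.apply_mem_of_mem_fanoPoints hpqr
  simp only [fanoPoints, List.forall_mem_cons] at hmem
  obtain ⟨h₁, -, h₃, -, h₅, h₆, h₇, -⟩ := hmem
  obtain ⟨h₁₂₄, -, h₁₆₇, -, h₂₅₇, h₃₄₇, h₄₅₆⟩ := hτ.fano_lines hpqr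
  rw [← hpq, Finset.inter_self, hr, Finset.inter_comm] at h₁₂₄
  rw [← hpq] at h₂₅₇
  rw [hr, Finset.inter_self] at h₃₄₇
  rw [hr] at h₄₅₆
  exact configThree_or_configFour_or_configFive hN h₃ h₁ h₅ h₆ h₇ h₁₂₄ h₃₄₇ h₄₅₆ h₂₅₇ h₁₆₇

end IsLineLabelling

end Fano

section FanoPlane

variable {τ : (Fin 3 → ZMod 2) → Finset (Fin m)} {p q r s : Fin 3 → ZMod 2}

theorem two_lines_meet (hpqrs : [0, p, q, r, s].Nodup) :
    p + q + r = s ∨ p + q = r ∨ p + q = s ∨ r + s = p ∨ r + s = q := by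
  decide +revert

theorem IsLineLabelling.config_of_two_pairs (hτ : IsLineLabelling N τ) (hN : ∅ ∉ N)
    (hpqrs : [0, p, q, r, s].Nodup) (hpq : τ p = τ q) (hrs : τ r = τ s) :
    ConfigThree N ∨ ConfigFour N ∨ ConfigFive N := by
  have fano {u v w : Fin 3 → ZMod 2} := nodup_zero_cons_fanoPoints (p := u) (q := v) (r := w)
  obtain ⟨⟨hp, hq, hr, hs⟩, ⟨npq, npr, nps⟩, ⟨nqr, nqs⟩, nrs⟩ :
      (p ≠ 0 ∧ q ≠ 0 ∧ r ≠ 0 ∧ s ≠ 0) ∧ (p ≠ q ∧ p ≠ r ∧ p ≠ s) ∧ (q ≠ r ∧ q ≠ s) ∧ r ≠ s := by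
    simpa [eq_comm (a := (0 : Fin 3 → ZMod 2))] using hpqrs
  rcases two_lines_meet hpqrs with h | h | h | h | h
  · exact hτ.config_of_apply_add_add hN (fano hp hq hr npq npr nqr fun h' => hs (by
      rw [← h, h', ZModModule.add_self])) hpq (h ▸ hrs.symm)
  · exact hτ.config_of_apply_add hN (fano hp hq hs npq nps nqs (h ▸ nrs)) hpq (h ▸ hrs)
  · exact hτ.config_of_apply_add hN (fano hp hq hr npq npr nqr (h ▸ nrs.symm)) hpq (h ▸ hrs.symm)
  · exact hτ.config_of_apply_add hN (fano hr hs hq nrs nqr.symm nqs.symm (h ▸ npq)) hrs (h ▸ hpq)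
  · exact hτ.config_of_apply_add hN (fano hr hs hp nrs npr.symm nps.symm (h ▸ npq.symm)) hrs
      (h ▸ hpq.symm)

theorem exists_nodup_zero_cons_fanoPoints (hp : p ≠ 0) (hq : q ≠ 0) (hpq : p ≠ q) :
    ∃ r, (0 :: fanoPoints p q r).Nodup := by
  decide +revert

theorem IsLineLabelling.exists_config (hτ : IsLineLabelling N τ) (hN : ∅ ∉ N) :
    ConfigOne N ∨ ConfigTwo N ∨ ConfigThree N ∨ ConfigFour N ∨ ConfigFive N := by
  by_cases hinj : Set.InjOn τ {0}ᶜ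
  · exact .inl (hτ.configOne (p := ![1, 0, 0]) (q := ![0, 1, 0]) (r := ![0, 0, 1]) (by decide) hinj)
  simp only [Set.InjOn, not_forall, Set.mem_compl_singleton_iff] at hinj
  obtain ⟨p, hp, q, hq, hτpq, hpq⟩ := hinj
  right
  by_cases hinj' : Set.InjOn τ {0, q}ᶜ
  · obtain ⟨r, hpqr⟩ := exists_nodup_zero_cons_fanoPoints hp hq hpq
    exact .inl (hτ.configTwo hpqr hτpq hinj')
  simp only [Set.InjOn, not_forall, Set.mem_compl_iff, Set.mem_insert_iff, Set.mem_singleton_iff,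
    not_or] at hinj'
  obtain ⟨r, hr, s, hs, hτrs, hrs⟩ := hinj'
  right
  rcases eq_or_ne p r with rfl | hpr
  · exact .inr (hτ.configFour_or_configFive hN hp hq hs.1 hpq hrs (Ne.symm hs.2) hτpq hτrs)
  rcases eq_or_ne p s with rfl | hps
  · exact .inr (hτ.configFour_or_configFive hN hp hq hr.1 hpq hpr (Ne.symm hr.2) hτpq hτrs.symm)
  · refine hτ.config_of_two_pairs hN ?_ hτpq hτrs
    simp [hpq, hpr, hps, hrs, Ne.symm hp, Ne.symm hq, Ne.symm hr.1, Ne.symm hr.2, Ne.symm hs.1,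
      Ne.symm hs.2]

theorem exists_isLineLabelling_fin_three_iff (hN : ∅ ∉ N) :
    (∃ τ : (Fin 3 → ZMod 2) → Finset (Fin m), IsLineLabelling N τ) ↔
      ConfigOne N ∨ ConfigTwo N ∨ ConfigThree N ∨ ConfigFour N ∨ ConfigFive N := by
  refine ⟨fun ⟨τ, hτ⟩ => hτ.exists_config hN, ?_⟩
  rintro (⟨τ₁, h₁, τ₂, h₂, τ₃, h₃, τ₄, h₄, τ₅, h₅, τ₆, h₆, τ₇, h₇, -, h⟩ |
    ⟨τ₁, h₁, τ₂, h₂, τ₃, h₃, τ₄, h₄, τ₅, h₅, τ₆, h₆, -, h⟩ |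
    ⟨τ₁, h₁, τ₂, h₂, τ₃, h₃, τ₄, h₄, τ₅, h₅, -, h⟩ | ⟨τ₁, h₁, τ₂, h₂, τ₃, h₃, τ₄, h₄, -, h⟩ |
    ⟨τ₁, h₁, τ₂, h₂, τ₃, h₃, -, h⟩)
  · exact exists_isLineLabelling_of_fano h₁ h₂ h₃ h₄ h₅ h₆ h₇ h.1 h.2.1 h.2.2.1 h.2.2.2.1
      h.2.2.2.2.1 h.2.2.2.2.2.1 h.2.2.2.2.2.2
  · refine exists_isLineLabelling_of_fano h₁ h₁ h₂ h₃ h₄ h₅ h₆ ?_ ?_ ?_ ?_ ?_ ?_ ?_ <;> grind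
  · refine exists_isLineLabelling_of_fano h₁ h₁ h₂ h₅ h₂ h₃ h₄ ?_ ?_ ?_ ?_ ?_ ?_ ?_ <;> grind
  · refine exists_isLineLabelling_of_fano h₁ h₁ h₁ h₂ h₃ h₄ h₁ ?_ ?_ ?_ ?_ ?_ ?_ ?_ <;> grind
  · refine exists_isLineLabelling_of_fano h₁ h₁ h₁ h₂ h₂ h₃ h₁ ?_ ?_ ?_ ?_ ?_ ?_ ?_ <;> grind

end FanoPlane

end Configurations

section BuchstaberInvariant

variable {K : PreAbstractSimplicialComplex (Fin m)}

theorem le_buchstaberInvariant_iff_exists_isLineLabelling {r : ℕ} (hr : r ≤ 3) :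
    r ≤ buchstaberInvariant K ↔
      ∃ τ : (Fin r → ZMod 2) → Finset (Fin m), IsLineLabelling (minNonSimplices K) τ := by
  constructor
  · intro h
    obtain ⟨Λ, hΛ⟩ := exists_isFreeModTwo_of_mem_freeToricDims
      (isGreatest_buchstaberInvariant K).1
    obtain ⟨τ, hτ⟩ := hΛ.exists_isLineLabelling
    obtain ⟨f, hf⟩ := (finrank_le_iff_exists_linearMap (R := ZMod 2)
      (M := Fin r → ZMod 2) (M' := Fin (buchstaberInvariant K) → ZMod 2)).mp (by simpa using h)
    exact ⟨τ ∘ f, hτ.comp f.toAddMonoidHom hf⟩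
  · rintro ⟨τ, hτ⟩
    obtain ⟨Λ, hΛ⟩ := hτ.exists_isFreeModTwo (by simpa using hr)
    exact (isGreatest_buchstaberInvariant K).2 (mem_freeToricDims_of_isFreeModTwo hr hΛ)

theorem one_le_buchstaberInvariant_iff :
    1 ≤ buchstaberInvariant K ↔ (minNonSimplices K).Nonempty := by
  rw [le_buchstaberInvariant_iff_exists_isLineLabelling (by norm_num)]
  constructor
  · rintro ⟨τ, hτ⟩
    exact ⟨τ 1, hτ.1 1 one_ne_zero⟩
  · rintro ⟨ω, hω⟩
    refine ⟨fun _ => ω, fun _ _ => hω, fun u v w hu hv hw h => ?_⟩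
    exact absurd h ((by decide : ∀ u v w : Fin 1 → ZMod 2, u ≠ 0 → v ≠ 0 → w ≠ 0 → u + v + w ≠ 0)
      u v w hu hv hw)

theorem two_le_buchstaberInvariant_iff :
    2 ≤ buchstaberInvariant K ↔ HasDisjointPairOrTriple (minNonSimplices K) := by
  rw [le_buchstaberInvariant_iff_exists_isLineLabelling (by norm_num),
    exists_isLineLabelling_fin_two_iff, hasDisjointPairOrTriple_iff empty_notMem_minNonSimplices]

theorem three_le_buchstaberInvariant_iff :
    3 ≤ buchstaberInvariant K ↔ ConfigOne (minNonSimplices K) ∨ ConfigTwo (minNonSimplices K) ∨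
      ConfigThree (minNonSimplices K) ∨ ConfigFour (minNonSimplices K) ∨
        ConfigFive (minNonSimplices K) := by
  rw [le_buchstaberInvariant_iff_exists_isLineLabelling le_rfl,
    exists_isLineLabelling_fin_three_iff empty_notMem_minNonSimplices]

end BuchstaberInvariant

end Buchstaber

theorem mainTheorem2 (m : ℕ) (K : PreAbstractSimplicialComplex (Fin m)) :
    ((Buchstaber.buchstaberInvariant K = 0 ↔ Buchstaber.minNonSimplices K = ∅) ∧
      (Buchstaber.buchstaberInvariant K = 0 ↔ Buchstaber.IsFullSimplex K)) ∧
    (Buchstaber.buchstaberInvariant K = 1 ↔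
      (Buchstaber.minNonSimplices K).Nonempty ∧
      (∀ τ₁ ∈ Buchstaber.minNonSimplices K, ∀ τ₂ ∈ Buchstaber.minNonSimplices K,
        [τ₁, τ₂].Nodup → (τ₁ ∩ τ₂).Nonempty) ∧
      (∀ τ₁ ∈ Buchstaber.minNonSimplices K, ∀ τ₂ ∈ Buchstaber.minNonSimplices K,
        ∀ τ₃ ∈ Buchstaber.minNonSimplices K,
        [τ₁, τ₂, τ₃].Nodup → (τ₁ ∩ τ₂ ∩ τ₃).Nonempty)) ∧
    (Buchstaber.buchstaberInvariant K = 2 ↔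
      Buchstaber.HasDisjointPairOrTriple (Buchstaber.minNonSimplices K) ∧
      ¬ Buchstaber.ConfigOne (Buchstaber.minNonSimplices K) ∧
      ¬ Buchstaber.ConfigTwo (Buchstaber.minNonSimplices K) ∧
      ¬ Buchstaber.ConfigThree (Buchstaber.minNonSimplices K) ∧
      ¬ Buchstaber.ConfigFour (Buchstaber.minNonSimplices K) ∧
      ¬ Buchstaber.ConfigFive (Buchstaber.minNonSimplices K)) := by
  have hzero : Buchstaber.buchstaberInvariant K = 0 ↔ Buchstaber.minNonSimplices K = ∅ := by
    rw [← Set.not_nonempty_iff_eq_empty, ← Buchstaber.one_le_buchstaberInvariant_iff]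
    omega
  refine ⟨⟨hzero, hzero.trans Buchstaber.isFullSimplex_iff_minNonSimplices_eq_empty.symm⟩, ?_, ?_⟩
  · rw [← Buchstaber.one_le_buchstaberInvariant_iff]
    trans 1 ≤ Buchstaber.buchstaberInvariant K ∧ ¬ 2 ≤ Buchstaber.buchstaberInvariant K
    · omega
    refine and_congr_right fun _ => ?_
    rw [Buchstaber.two_le_buchstaberInvariant_iff, Buchstaber.HasDisjointPairOrTriple, not_or]
    simp only [not_exists, not_and, Finset.nonempty_iff_ne_empty, ne_eq]
  · trans 2 ≤ Buchstaber.buchstaberInvariant K ∧ ¬ 3 ≤ Buchstaber.buchstaberInvariant K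
    · omega
    rw [Buchstaber.two_le_buchstaberInvariant_iff, Buchstaber.three_le_buchstaberInvariant_iff]
    simp only [not_or]
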